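/- Let $A$ and $B$ be $C^*$-algebras with $A$ unital ($B$ need not be unital), let $\varepsilon\ge 0$, and let $\varphi\colon A\to B$ be a bounded linear operator which is an $\varepsilon$-order zero map, i.e. $\|\varphi(x)\varphi(y)\|\le\varepsilon\|x\|\,\|y\|$ for all positive $x,y\in A$ with $x\perp y$ (that is, $xy=yx=x^*y=xy^*=0$). Put $h=\varphi(1_A)$ and $\|\varphi\|_+=\sup\{\|\varphi(x)\|\colon x\in A,\ x\ge 0,\ \|x\|\le 1\}$. For a complex polynomial $P$ the element $P(h)$ is taken in $B$ if $B$ is unital, and in the unitization of $B$ (with its $C^*$-norm) otherwise; equivalently, in the multiplier algebra of $B$. Let $\tau$ denote the left shift on coefficients, $\tau P(z)=z^{-1}(P(z)-P(0))$, and define $\Theta_N(P)$ for complex polynomials $P$ of degree $N\ge 1$ recursively by $$\Theta_1(az+b)=8|a|\varepsilon,\qquad \Theta_N(P)=8\|\varphi\|_+\,\Theta_{N-1}(\tau P)+8\|\tau P(h)\|\,\varepsilon\quad (N\ge 2).$$ Then for every complex polynomial $P$ of degree $N>0$ and every positive $x\in A$, $$\|P(h)\varphi(x)-\varphi(x)P(h)\|\le\Theta_N(P)\,\|x\|.$$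 -/

import Mathlib

/-!
Let `β` be a bounded bilinear map on `A × A` that is small on orthogonal positive pairs, such as
`β (x, y) = φ x * φ y`. To compare `β (1, x)` with `β (x, 1)` for `x ≥ 0`, pass to
`C(spectrum x, ℝ)` and cut a large multiple of `x` into layers of height one,
`m x = r 1 + ⋯ + r n` with `n ≈ m ‖x‖`, where `r 0 = 1` and `r k = 1` on the support of
`r (k + 1)`. In `β (1, r (k + 1)) - β (r (k + 1), 1)`, split
`1 = (1 - r k) + (r k - r (k + 1)) + r (k + 1)`. Up to orthogonal pairs, each contributing at most
`ε`, only `β (r k - r (k + 1), r (k + 1) - r (k + 2))` and its mirror image are left. The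
differences `r k - r (k + 1)` are slices of a partition of unity, so averaging over random signs
bounds the sum of these terms over `k` by `‖β‖`, independently of `n`. Dividing by `m → ∞` leaves
`‖β (1, x) - β (x, 1)‖ ≤ 4 ε ‖x‖`.

For `β (x, y) = φ x * φ y` this bounds the commutator of `h = φ 1` with `φ x`, and the identity
`[P(h), y] = h [τP(h), y] + [h, y] τP(h)` passes the bound on to polynomials.
-/

open scoped MultiplierAlgebra Polynomial

noncomputable section

namespace EpsOrderZero

/-- Orthogonality in a C*-algebra: `xy = yx = x*y = xy* = 0`. -/
def Orthogonal {A : Type*} [NonUnitalCStarAlgebra A] (x y : A) : Prop :=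
  x * y = 0 ∧ y * x = 0 ∧ star x * y = 0 ∧ x * star y = 0

/-- `φ` is an `ε`-order zero map, where `ε ≥ 0`. -/
def IsEpsOrderZero {A B : Type*} [NonUnitalCStarAlgebra A] [PartialOrder A] [StarOrderedRing A]
    [NonUnitalCStarAlgebra B] (ε : ℝ) (φ : A →L[ℂ] B) : Prop :=
  0 ≤ ε ∧ ∀ x y : A, 0 ≤ x → 0 ≤ y → Orthogonal x y → ‖φ x * φ y‖ ≤ ε * ‖x‖ * ‖y‖

/-- `‖φ‖₊ = sup {‖φ x‖ : x ≥ 0, ‖x‖ ≤ 1}`; the set is nonempty and bounded above by `‖φ‖`. -/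
def normPos {A B : Type*} [NonUnitalCStarAlgebra A] [PartialOrder A] [StarOrderedRing A]
    [NonUnitalCStarAlgebra B] (φ : A →L[ℂ] B) : ℝ :=
  sSup {r : ℝ | ∃ x : A, 0 ≤ x ∧ ‖x‖ ≤ 1 ∧ r = ‖φ x‖}

/-- The value `P(b)`. As `B` need not have a unit, it is taken in the multiplier algebra of `B`,
which is `B` itself if `B` is unital (see `polyAt_eq_coe`, `norm_polyAt`), and contains the
unitization of `B` isometrically if it is not. -/
def polyAt {B : Type*} [NonUnitalCStarAlgebra B] (P : ℂ[X]) (b : B) : 𝓜(ℂ, B) :=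
  Polynomial.aeval (b : 𝓜(ℂ, B)) P

/-- The numbers `Θ_N(P)` attached to `φ` and `ε`; the left shift `τ` of the coefficients is
`Polynomial.divX`. The value at `N = 0` is a placeholder. -/
def theta {A B : Type*} [CStarAlgebra A] [PartialOrder A] [StarOrderedRing A]
    [NonUnitalCStarAlgebra B] (φ : A →L[ℂ] B) (ε : ℝ) : ℕ → ℂ[X] → ℝ
  | 0, _ => 0
  | 1, P => 8 * ‖P.coeff 1‖ * ε
  | N + 2, P => 8 * normPos φ * theta φ ε (N + 1) P.divX + 8 * ‖polyAt P.divX (φ 1)‖ * ε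

/-- For unital `B`, the value `P(b)` is the usual one. -/
theorem polyAt_eq_coe {B : Type*} [CStarAlgebra B] (P : ℂ[X]) (b : B) :
    polyAt P b = ((Polynomial.aeval b P : B) : 𝓜(ℂ, B)) := by
  have h1 : ((1 : B) : 𝓜(ℂ, B)) = 1 := by
    ext x <;> simp
  have hm : ∀ x y : B, ((x * y : B) : 𝓜(ℂ, B)) = x * y := fun x y =>
    map_mul (DoubleCentralizer.coeHom (𝕜 := ℂ) (A := B)) x y
  have ha : ∀ x y : B, ((x + y : B) : 𝓜(ℂ, B)) = x + y := fun x y =>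
    map_add (DoubleCentralizer.coeHom (𝕜 := ℂ) (A := B)) x y
  have hs : ∀ (c : ℂ) (x : B), ((c • x : B) : 𝓜(ℂ, B)) = c • (x : 𝓜(ℂ, B)) := fun c x =>
    map_smul (DoubleCentralizer.coeHom (𝕜 := ℂ) (A := B)) c x
  unfold polyAt
  induction P using Polynomial.induction_on with
  | C a => simp [Algebra.algebraMap_eq_smul_one, hs, h1]
  | add p q hp hq => simp [ha, hp, hq]
  | monomial n a h =>
    rw [pow_succ, ← mul_assoc, map_mul, h, Polynomial.aeval_X, ← hm]
    simp only [map_mul, Polynomial.aeval_X]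

theorem norm_polyAt {B : Type*} [CStarAlgebra B] (P : ℂ[X]) (b : B) :
    ‖polyAt P b‖ = ‖(Polynomial.aeval b P : B)‖ := by
  rw [polyAt_eq_coe, ← DoubleCentralizer.norm_fst, DoubleCentralizer.coe_fst,
    ContinuousLinearMap.opNorm_mul_apply]

end EpsOrderZero

end

namespace EpsOrderZero

open Finset Polynomial

section SignAverage

theorem sum_insert_update_smul {ι R V : Type*} [DecidableEq ι] [AddCommMonoid V] [SMul R V]
    {S : Finset ι} {j : ι} (hj : j ∉ S) (s : ι → R) (c : R) (f : ι → V) :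
    ∑ i ∈ insert j S, Function.update s j c i • f i = c • f j + ∑ i ∈ S, s i • f i := by
  rw [sum_insert hj, Function.update_self]
  congr 1
  exact sum_congr rfl fun i hi => by rw [Function.update_of_ne (ne_of_mem_of_not_mem hi hj)]

theorem norm_add_sum_le_of_forall_sign {ι E F G : Type*} [AddCommGroup E] [Module ℝ E]
    [AddCommGroup F] [Module ℝ F] [SeminormedAddCommGroup G] [NormedSpace ℝ G]
    (β : E →ₗ[ℝ] F →ₗ[ℝ] G) (a : ι → E) (b : ι → F) (S : Finset ι) (w : G) {C : ℝ}
    (h : ∀ s : ι → ℝ, (∀ i, |s i| = 1) →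
      ‖w + β (∑ i ∈ S, s i • a i) (∑ i ∈ S, s i • b i)‖ ≤ C) :
    ‖w + ∑ i ∈ S, β (a i) (b i)‖ ≤ C := by
  classical
  induction S using Finset.induction_on generalizing w with
  | empty => simpa using h 1 (by simp)
  | insert j S hj ih =>
    rw [sum_insert hj, ← add_assoc]
    refine ih _ fun s hs => ?_
    set u := ∑ i ∈ S, s i • a i
    set v := ∑ i ∈ S, s i • b i
    have h_extend (c : ℝ) (hc : |c| = 1) : ‖w + β (c • a j + u) (c • b j + v)‖ ≤ C := by
      simpa only [sum_insert_update_smul hj] using h (Function.update s j c)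
        ((Function.forall_update_iff s fun _ y => |y| = 1).2 ⟨hc, fun i _ => hs i⟩)
    have h_average : w + β (a j) (b j) + β u v = midpoint ℝ
        (w + β ((1 : ℝ) • a j + u) ((1 : ℝ) • b j + v))
        (w + β ((-1 : ℝ) • a j + u) ((-1 : ℝ) • b j + v)) := by
      simp only [midpoint_eq_smul_add, invOf_eq_inv, map_add, map_smul, LinearMap.add_apply,
        LinearMap.smul_apply]
      module
    rw [h_average, ← mem_closedBall_zero_iff]
    exact (convex_closedBall 0 C).midpoint_mem (mem_closedBall_zero_iff.2 (h_extend 1 (by simp)))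
      (mem_closedBall_zero_iff.2 (h_extend (-1) (by simp)))

end SignAverage

section Staircase

variable {K : Type*} [TopologicalSpace K]

/-- A sequence of functions `K → [0, 1]`, each equal to `1` wherever the next one is nonzero. -/
structure IsStaircase (r : ℕ → C(K, ℝ)) : Prop where
  mem_Icc (k : ℕ) : r k ∈ Set.Icc 0 1
  one_sub_mul_succ (k : ℕ) : (1 - r k) * r (k + 1) = 0

namespace IsStaircase

variable {r : ℕ → C(K, ℝ)}

theorem eq_one_or_succ_eq_zero (hr : IsStaircase r) (k : ℕ) (t : K) :
    r k t = 1 ∨ r (k + 1) t = 0 :=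
  (mul_eq_zero.1 (DFunLike.congr_fun (hr.one_sub_mul_succ k) t)).imp_left
    fun h => (sub_eq_zero.1 h).symm

theorem antitone (hr : IsStaircase r) : Antitone r :=
  antitone_nat_of_succ_le fun k t => by
    rcases hr.eq_one_or_succ_eq_zero k t with h | h
    · exact ((hr.mem_Icc (k + 1)).2 t).trans h.ge
    · exact h.trans_le ((hr.mem_Icc k).1 t)

theorem sub_succ_mul_add_two (hr : IsStaircase r) (k : ℕ) :
    (r k - r (k + 1)) * r (k + 2) = 0 := by
  ext t
  rcases hr.eq_one_or_succ_eq_zero (k + 1) t with h | h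
  · have hk : r k t = 1 :=
      le_antisymm ((hr.mem_Icc k).2 t) (h.ge.trans (hr.antitone k.le_succ t))
    simp [h, hk]
  · simp [h]

theorem sub_succ_mem_Icc (hr : IsStaircase r) (k : ℕ) : r k - r (k + 1) ∈ Set.Icc 0 1 :=
  ⟨sub_nonneg.2 (hr.antitone k.le_succ),
    (sub_le_self _ (hr.mem_Icc (k + 1)).1).trans (hr.mem_Icc k).2⟩

theorem comp_succ (hr : IsStaircase r) : IsStaircase fun k => r (k + 1) :=
  ⟨fun k => hr.mem_Icc (k + 1), fun k => hr.one_sub_mul_succ (k + 1)⟩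

end IsStaircase

/-- The part of `g` between the heights `k - 1` and `k`, so that `g = ∑ k ≥ 1, layer g k` if
`g ≥ 0`. The heights are shifted by one so that `layer g 0 = 1` starts the staircase. -/
def layer (g : C(K, ℝ)) (k : ℕ) : C(K, ℝ) := 0 ⊔ (g + 1 - k) ⊓ 1

theorem layer_apply (g : C(K, ℝ)) (k : ℕ) (t : K) : layer g k t = max 0 (min (g t + 1 - k) 1) :=
  rfl

theorem isStaircase_layer (g : C(K, ℝ)) : IsStaircase (layer g) where
  mem_Icc _ := ⟨le_sup_left, sup_le zero_le_one inf_le_right⟩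
  one_sub_mul_succ k := by
    ext t
    simp only [ContinuousMap.mul_apply, ContinuousMap.sub_apply, ContinuousMap.one_apply,
      ContinuousMap.zero_apply, layer_apply, Nat.cast_add, Nat.cast_one, mul_eq_zero]
    grind

theorem sum_range_layer_succ {g : C(K, ℝ)} (hg : 0 ≤ g) (n : ℕ) :
    ∑ k ∈ range n, layer g (k + 1) = g ⊓ n := by
  induction n with
  | zero => simpa using hg
  | succ n ih =>
    ext t
    simp only [sum_range_succ, ih, ContinuousMap.add_apply, ContinuousMap.inf_apply,
      ContinuousMap.natCast_apply, layer_apply, Nat.cast_add, Nat.cast_one,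
      ContinuousMap.one_apply]
    grind

variable [CompactSpace K]

theorem norm_le_one_of_mem_Icc {f : C(K, ℝ)} (hf : f ∈ Set.Icc 0 1) : ‖f‖ ≤ 1 :=
  (ContinuousMap.norm_le f zero_le_one).2 fun t =>
    abs_le.2 ⟨(neg_nonpos.2 zero_le_one).trans (hf.1 t), hf.2 t⟩

theorem norm_sum_smul_sub_succ_le {r : ℕ → C(K, ℝ)} (hr : Antitone r)
    (h01 : ∀ k, r k ∈ Set.Icc 0 1) (n : ℕ) {s : ℕ → ℝ} (hs : ∀ k, |s k| ≤ 1) :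
    ‖∑ k ∈ range n, s k • (r k - r (k + 1))‖ ≤ 1 := by
  refine (ContinuousMap.norm_le _ zero_le_one).2 fun t => ?_
  rw [ContinuousMap.sum_apply]
  calc |∑ k ∈ range n, s k * (r k t - r (k + 1) t)|
      ≤ ∑ k ∈ range n, (r k t - r (k + 1) t) := by
        refine (abs_sum_le_sum_abs _ _).trans (sum_le_sum fun k _ => ?_)
        have hstep : 0 ≤ r k t - r (k + 1) t := sub_nonneg.2 (hr k.le_succ t)
        rw [abs_mul, abs_of_nonneg hstep]
        exact mul_le_of_le_one_left hstep (hs k)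
    _ = r 0 t - r n t := sum_range_sub' (fun k => r k t) n
    _ ≤ 1 := (sub_le_self _ ((h01 n).1 t)).trans ((h01 0).2 t)

variable {G : Type*} [SeminormedAddCommGroup G] [NormedSpace ℝ G]
  {β : C(K, ℝ) →ₗ[ℝ] C(K, ℝ) →ₗ[ℝ] G} {C : ℝ}

theorem IsStaircase.norm_sum_apply_sub_succ_le {r : ℕ → C(K, ℝ)} (hr : IsStaircase r)
    (hC : ∀ f g, ‖f‖ ≤ 1 → ‖g‖ ≤ 1 → ‖β f g‖ ≤ C) (n : ℕ) :
    ‖∑ k ∈ range n, β (r k - r (k + 1)) (r (k + 1) - r (k + 2))‖ ≤ C := by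
  rw [← zero_add (∑ k ∈ range n, _)]
  refine norm_add_sum_le_of_forall_sign β _ _ _ 0 fun s hs => ?_
  rw [zero_add]
  exact hC _ _
    (norm_sum_smul_sub_succ_le hr.antitone hr.mem_Icc n fun k => (hs k).le)
    (norm_sum_smul_sub_succ_le hr.comp_succ.antitone hr.comp_succ.mem_Icc n fun k => (hs k).le)

variable {ε : ℝ} (hε : 0 ≤ ε)
  (hβ : ∀ f g : C(K, ℝ), 0 ≤ f → 0 ≤ g → f * g = 0 → ‖β f g‖ ≤ ε * ‖f‖ * ‖g‖)

include hε hβ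

theorem norm_apply_sub_apply_swap_le {f g : C(K, ℝ)} (hf : f ∈ Set.Icc 0 1)
    (hg : g ∈ Set.Icc 0 1) (hfg : f * g = 0) : ‖β f g - β g f‖ ≤ 2 * ε := by
  have hle {p q : C(K, ℝ)} (hp : p ∈ Set.Icc 0 1) (hq : q ∈ Set.Icc 0 1) (hpq : p * q = 0) :
      ‖β p q‖ ≤ ε :=
    calc ‖β p q‖ ≤ ε * ‖p‖ * ‖q‖ := hβ p q hp.1 hq.1 hpq
      _ ≤ ε * 1 * 1 := by gcongr <;> exact norm_le_one_of_mem_Icc ‹_›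
      _ = ε := by ring
  calc ‖β f g - β g f‖ ≤ ‖β f g‖ + ‖β g f‖ := norm_sub_le _ _
    _ ≤ ε + ε := add_le_add (hle hf hg hfg) (hle hg hf (by rwa [mul_comm]))
    _ = 2 * ε := (two_mul ε).symm

theorem IsStaircase.norm_sum_apply_one_sub_apply_one_le {r : ℕ → C(K, ℝ)} (hr : IsStaircase r)
    (hC : ∀ f g, ‖f‖ ≤ 1 → ‖g‖ ≤ 1 → ‖β f g‖ ≤ C) (n : ℕ) :
    ‖∑ k ∈ range n, (β 1 (r (k + 1)) - β (r (k + 1)) 1)‖ ≤ n * (4 * ε) + 2 * C := by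
  let far (k : ℕ) : G :=
    (β (1 - r k) (r (k + 1)) - β (r (k + 1)) (1 - r k)) +
      (β (r k - r (k + 1)) (r (k + 2)) - β (r (k + 2)) (r k - r (k + 1)))
  have hsplit (k : ℕ) : β 1 (r (k + 1)) - β (r (k + 1)) 1 = far k +
      (β (r k - r (k + 1)) (r (k + 1) - r (k + 2))
        - β.flip (r k - r (k + 1)) (r (k + 1) - r (k + 2))) := by
    simp only [far, map_sub, LinearMap.sub_apply, LinearMap.flip_apply]
    abel
  have hfar : ‖∑ k ∈ range n, far k‖ ≤ n * (4 * ε) := by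
    refine (norm_sum_le_of_le (range n) fun k _ => (?_ : ‖far k‖ ≤ 4 * ε)).trans (by simp)
    have hcompl : 1 - r k ∈ Set.Icc (0 : C(K, ℝ)) 1 :=
      ⟨sub_nonneg.2 (hr.mem_Icc k).2, sub_le_self _ (hr.mem_Icc k).1⟩
    refine (norm_add_le_of_le
      (norm_apply_sub_apply_swap_le hε hβ hcompl (hr.mem_Icc _) (hr.one_sub_mul_succ k))
      (norm_apply_sub_apply_swap_le hε hβ (hr.sub_succ_mem_Icc k) (hr.mem_Icc _)
        (hr.sub_succ_mul_add_two k))).trans_eq ?_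
    ring
  have hnear := norm_sub_le_of_le (hr.norm_sum_apply_sub_succ_le hC n)
    (hr.norm_sum_apply_sub_succ_le (β := β.flip) (fun f g hf hg => hC g f hg hf) n)
  rw [← two_mul] at hnear
  rw [sum_congr rfl fun k _ => hsplit k, sum_add_distrib, sum_sub_distrib]
  exact norm_add_le_of_le hfar hnear

theorem norm_apply_one_sub_apply_one_le_add (hC : ∀ f g, ‖f‖ ≤ 1 → ‖g‖ ≤ 1 → ‖β f g‖ ≤ C)
    {g : C(K, ℝ)} (hg : 0 ≤ g) {n : ℕ} (hn : g ≤ n) :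
    ‖β 1 g - β g 1‖ ≤ n * (4 * ε) + 2 * C := by
  have hsum : ∑ k ∈ range n, layer g (k + 1) = g := by
    rw [sum_range_layer_succ hg, inf_eq_left.2 hn]
  have hlayers := (isStaircase_layer g).norm_sum_apply_one_sub_apply_one_le hε hβ hC n
  rwa [sum_sub_distrib, ← map_sum, ← LinearMap.sum_apply, ← map_sum, hsum] at hlayers

theorem norm_apply_one_sub_apply_one_le_of_continuousMap
    (hC : ∀ f g, ‖f‖ ≤ 1 → ‖g‖ ≤ 1 → ‖β f g‖ ≤ C) {g : C(K, ℝ)} (hg : 0 ≤ g) :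
    ‖β 1 g - β g 1‖ ≤ 4 * ε * ‖g‖ := by
  have hscaled (m : ℕ) :
      m * ‖β 1 g - β g 1‖ ≤ m * (4 * ε * ‖g‖) + (4 * ε + 2 * C) := by
    set n := ⌈m * ‖g‖⌉₊
    have hle : m • g ≤ n := fun t =>
      calc (m • g) t = m * g t := by simp
        _ ≤ m * ‖g‖ := by gcongr; exact (le_abs_self _).trans (g.norm_coe_le_norm t)
        _ ≤ n := Nat.le_ceil _
    have hn : (n : ℝ) ≤ m * ‖g‖ + 1 := (Nat.ceil_lt_add_one (by positivity)).le
    calc m * ‖β 1 g - β g 1‖ = ‖β 1 (m • g) - β (m • g) 1‖ := by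
          rw [map_nsmul, map_nsmul, LinearMap.smul_apply, ← smul_sub,
            ← Nat.cast_smul_eq_nsmul ℝ, norm_smul, Real.norm_natCast]
      _ ≤ n * (4 * ε) + 2 * C :=
          norm_apply_one_sub_apply_one_le_add hε hβ hC (nsmul_nonneg hg m) hle
      _ ≤ (m * ‖g‖ + 1) * (4 * ε) + 2 * C := by gcongr
      _ = m * (4 * ε * ‖g‖) + (4 * ε + 2 * C) := by ring
  by_contra! hlt
  obtain ⟨m, hm⟩ := exists_lt_nsmul (sub_pos.2 hlt) (4 * ε + 2 * C)
  rw [nsmul_eq_mul] at hm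
  linarith [hscaled m]

end Staircase

theorem norm_apply_one_sub_apply_one_le {A G : Type*} [CStarAlgebra A] [PartialOrder A]
    [StarOrderedRing A] [SeminormedAddCommGroup G] [NormedSpace ℝ G] {β : A →L[ℝ] A →L[ℝ] G} {ε : ℝ}
    (hε : 0 ≤ ε) (hβ : ∀ x y : A, 0 ≤ x → 0 ≤ y → x * y = 0 → ‖β x y‖ ≤ ε * ‖x‖ * ‖y‖)
    {x : A} (hx : 0 ≤ x) : ‖β 1 x - β x 1‖ ≤ 4 * ε * ‖x‖ := by
  have hsa : IsSelfAdjoint x := .of_nonneg hx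
  let Ψ := cfcHom (R := ℝ) hsa
  have hnorm (f) : ‖Ψ f‖ = ‖f‖ := norm_cfcHom x f
  have hnonneg {f} (hf : 0 ≤ f) : 0 ≤ Ψ f := (cfcHom_nonneg_iff hsa).2 hf
  let g : C(spectrum ℝ x, ℝ) := .restrict (spectrum ℝ x) (.id ℝ)
  have hg : 0 ≤ g := fun t => spectrum_nonneg_of_nonneg hx t.2
  have hΨg : Ψ g = x := cfcHom_id hsa
  let γ := β.toLinearMap₁₂.compl₁₂ Ψ.toAlgHom.toLinearMap Ψ.toAlgHom.toLinearMap
  have hγ (p q) (hp : 0 ≤ p) (hq : 0 ≤ q) (hpq : p * q = 0) : ‖γ p q‖ ≤ ε * ‖p‖ * ‖q‖ := by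
    rw [← hnorm p, ← hnorm q]
    exact hβ (Ψ p) (Ψ q) (hnonneg hp) (hnonneg hq) (by rw [← map_mul, hpq, map_zero])
  have hγ_bound (p q) (hp : ‖p‖ ≤ 1) (hq : ‖q‖ ≤ 1) : ‖γ p q‖ ≤ ‖β‖ := by
    change ‖β (Ψ p) (Ψ q)‖ ≤ ‖β‖
    simpa using β.le_of_opNorm₂_le_of_le le_rfl ((hnorm p).trans_le hp) ((hnorm q).trans_le hq)
  have hswap : ‖β (Ψ 1) (Ψ g) - β (Ψ g) (Ψ 1)‖ ≤ 4 * ε * ‖g‖ :=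
    norm_apply_one_sub_apply_one_le_of_continuousMap hε hγ hγ_bound hg
  rwa [← hnorm, hΨg, map_one] at hswap

section PolynomialCommutator

theorem aeval_commutator_eq {R M : Type*} [CommSemiring R] [Ring M] [Algebra R M] (b y : M)
    (P : R[X]) :
    aeval b P * y - y * aeval b P =
      b * (aeval b P.divX * y - y * aeval b P.divX) + (b * y - y * b) * aeval b P.divX := by
  conv_lhs => rw [← P.X_mul_divX_add]
  simp only [map_add, map_mul, aeval_X, aeval_C, add_mul, mul_add,
    Algebra.commutes (P.coeff 0) y]
  noncomm_ring

theorem sum_range_succ_pow_mul_iterate {α S : Type*} [CommSemiring S] (τ : α → α) (f : α → S)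
    (c : S) (N : ℕ) (p : α) :
    ∑ k ∈ range (N + 1), c ^ k * f (τ^[k + 1] p) =
      c * ∑ k ∈ range N, c ^ k * f (τ^[k + 1] (τ p)) + f (τ p) := by
  simp only [sum_range_succ', mul_sum, pow_succ', mul_assoc, pow_zero, one_mul,
    Function.iterate_succ_apply, Function.iterate_zero_apply]

theorem norm_aeval_commutator_le {R M : Type*} [CommSemiring R] [SeminormedRing M]
    [Algebra R M] (b y : M) {N : ℕ} {P : R[X]} (hP : P.natDegree ≤ N) :
    ‖aeval b P * y - y * aeval b P‖ ≤
      (∑ k ∈ range N, ‖b‖ ^ k * ‖aeval b (divX^[k + 1] P)‖) * ‖b * y - y * b‖ := by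
  induction N generalizing P with
  | zero =>
    rw [eq_C_of_natDegree_le_zero hP, aeval_C, Algebra.commutes, sub_self]
    simp
  | succ N ih =>
    have hdivX : P.divX.natDegree ≤ N := by
      rw [natDegree_divX_eq_natDegree_tsub_one]
      omega
    set c := ‖b * y - y * b‖
    calc ‖aeval b P * y - y * aeval b P‖
        ≤ ‖b‖ * ‖aeval b P.divX * y - y * aeval b P.divX‖ + c * ‖aeval b P.divX‖ := by
          rw [aeval_commutator_eq]
          exact norm_add_le_of_le (norm_mul_le _ _) (norm_mul_le _ _)
      _ ≤ ‖b‖ * ((∑ k ∈ range N, ‖b‖ ^ k * ‖aeval b (divX^[k + 1] P.divX)‖) * c)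
            + c * ‖aeval b P.divX‖ := by
          gcongr
          exact ih hdivX
      _ = (∑ k ∈ range (N + 1), ‖b‖ ^ k * ‖aeval b (divX^[k + 1] P)‖) * c := by
          rw [sum_range_succ_pow_mul_iterate divX fun Q => ‖aeval b Q‖]
          ring

end PolynomialCommutator

section OrderZero

variable {A B : Type*} [CStarAlgebra A] [PartialOrder A] [StarOrderedRing A]
  [NonUnitalCStarAlgebra B]

theorem norm_map_one_le_normPos (φ : A →L[ℂ] B) : ‖φ 1‖ ≤ normPos φ := by
  refine le_csSup ⟨‖φ‖, ?_⟩ ⟨1, zero_le_one, ?_, rfl⟩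
  · rintro _ ⟨x, -, hx, rfl⟩
    exact φ.unit_le_opNorm x hx
  · nontriviality A
    exact CStarRing.norm_one.le

theorem norm_coe_multiplier (b : B) : ‖(b : 𝓜(ℂ, B))‖ = ‖b‖ := by
  rw [← DoubleCentralizer.norm_fst, DoubleCentralizer.coe_fst,
    ContinuousLinearMap.opNorm_mul_apply]

/-- The isometric embedding of `B` into its multiplier algebra, in which `polyAt` takes values. -/
noncomputable def multiplierEmbedding (B : Type*) [NonUnitalCStarAlgebra B] :
    B →ₗᵢ[ℂ] 𝓜(ℂ, B) where
  toLinearMap := (DoubleCentralizer.coeHom (𝕜 := ℂ) (A := B) : B →ₗ[ℂ] 𝓜(ℂ, B))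
  norm_map' := norm_coe_multiplier

theorem multiplierEmbedding_mul (b c : B) :
    multiplierEmbedding B (b * c) = multiplierEmbedding B b * multiplierEmbedding B c :=
  map_mul (DoubleCentralizer.coeHom (𝕜 := ℂ) (A := B)) b c

theorem IsEpsOrderZero.norm_multiplierEmbedding_mul_le {φ : A →L[ℂ] B} {ε : ℝ}
    (hφ : IsEpsOrderZero ε φ) {x y : A} (hx : 0 ≤ x) (hy : 0 ≤ y) (hxy : x * y = 0) :
    ‖multiplierEmbedding B (φ x) * multiplierEmbedding B (φ y)‖ ≤ ε * ‖x‖ * ‖y‖ := by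
  have hx' : star x = x := IsSelfAdjoint.of_nonneg hx
  have hy' : star y = y := IsSelfAdjoint.of_nonneg hy
  have hyx : y * x = 0 := by simpa [hx', hy'] using congrArg star hxy
  rw [← multiplierEmbedding_mul, LinearIsometry.norm_map]
  exact hφ.2 x y hx hy ⟨hxy, hyx, by rwa [hx'], by rwa [hy']⟩

theorem norm_polyAt_divX_le {P : ℂ[X]} (hP : P.natDegree ≤ 1) (b : B) :
    ‖polyAt P.divX b‖ ≤ ‖P.coeff 1‖ := by
  have hdivX : P.divX = C (P.coeff 1) := by
    rw [eq_C_of_natDegree_eq_zero (p := P.divX) (by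
      rw [natDegree_divX_eq_natDegree_tsub_one]; omega), coeff_divX]
  rw [hdivX, polyAt, aeval_C, norm_algebraMap]
  refine mul_le_of_le_one_right (norm_nonneg _) ?_
  nontriviality 𝓜(ℂ, B)
  exact CStarRing.norm_one.le

theorem four_mul_sum_le_theta (φ : A →L[ℂ] B) {ε : ℝ} (hε : 0 ≤ ε) {N : ℕ} {P : ℂ[X]}
    (hP : P.natDegree ≤ N) :
    4 * ε * ∑ k ∈ range N, ‖(φ 1 : 𝓜(ℂ, B))‖ ^ k * ‖polyAt (divX^[k + 1] P) (φ 1)‖ ≤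
      theta φ ε N P := by
  induction N using Nat.twoStepInduction generalizing P with
  | zero => simp [theta]
  | one =>
    calc _ = 4 * ‖polyAt P.divX (φ 1)‖ * ε := by simp; ring
      _ ≤ 8 * ‖P.coeff 1‖ * ε := by
        gcongr
        · norm_num
        · exact norm_polyAt_divX_le hP (φ 1)
  | more N _ ih =>
    have hdivX : P.divX.natDegree ≤ N + 1 := by
      rw [natDegree_divX_eq_natDegree_tsub_one]
      omega
    have hnorm : ‖(φ 1 : 𝓜(ℂ, B))‖ ≤ 8 * normPos φ := by
      rw [norm_coe_multiplier]
      linarith [norm_map_one_le_normPos φ, norm_nonneg (φ 1)]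
    rw [sum_range_succ_pow_mul_iterate divX fun Q => ‖polyAt Q (φ 1)‖]
    set S := ∑ k ∈ range (N + 1),
      ‖(φ 1 : 𝓜(ℂ, B))‖ ^ k * ‖polyAt (divX^[k + 1] P.divX) (φ 1)‖
    calc 4 * ε * (‖(φ 1 : 𝓜(ℂ, B))‖ * S + ‖polyAt P.divX (φ 1)‖)
        = ‖(φ 1 : 𝓜(ℂ, B))‖ * (4 * ε * S) + 4 * ‖polyAt P.divX (φ 1)‖ * ε := by ring
      _ ≤ 8 * normPos φ * theta φ ε (N + 1) P.divX + 8 * ‖polyAt P.divX (φ 1)‖ * ε := by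
        gcongr
        · exact (norm_nonneg _).trans hnorm
        · exact ih hdivX
        · norm_num

end OrderZero

end EpsOrderZero

theorem proposition5p1_general {A M R : Type*} [CStarAlgebra A] [PartialOrder A]
    [StarOrderedRing A] [SeminormedRing M] [NormedAlgebra ℝ M] [CommSemiring R] [Algebra R M]
    (φ : A →L[ℝ] M) {ε : ℝ} (hε : 0 ≤ ε)
    (hφ : ∀ x y : A, 0 ≤ x → 0 ≤ y → x * y = 0 → ‖φ x * φ y‖ ≤ ε * ‖x‖ * ‖y‖)
    {P : R[X]} {N : ℕ} (hP : P.natDegree ≤ N) {x : A} (hx : 0 ≤ x) :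
    ‖Polynomial.aeval (φ 1) P * φ x - φ x * Polynomial.aeval (φ 1) P‖ ≤
      4 * ε * (∑ k ∈ Finset.range N,
        ‖φ 1‖ ^ k * ‖Polynomial.aeval (φ 1) (Polynomial.divX^[k + 1] P)‖) * ‖x‖ := by
  have hone : ‖φ 1 * φ x - φ x * φ 1‖ ≤ 4 * ε * ‖x‖ :=
    EpsOrderZero.norm_apply_one_sub_apply_one_le
      (β := (ContinuousLinearMap.mul ℝ M).bilinearComp φ φ) hε hφ hx
  refine (EpsOrderZero.norm_aeval_commutator_le (φ 1) (φ x) hP).trans ?_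
  refine (mul_le_mul_of_nonneg_left hone (by positivity)).trans_eq ?_
  ring

theorem proposition5p1 {A B : Type*} [CStarAlgebra A] [PartialOrder A] [StarOrderedRing A]
    [NonUnitalCStarAlgebra B] (φ : A →L[ℂ] B) (ε : ℝ) (hφ : EpsOrderZero.IsEpsOrderZero ε φ)
    (P : ℂ[X]) (N : ℕ) (hN : 0 < N) (hP : P.natDegree = N) (x : A) (hx : 0 ≤ x) :
    ‖EpsOrderZero.polyAt P (φ 1) * (φ x : 𝓜(ℂ, B))
        - (φ x : 𝓜(ℂ, B)) * EpsOrderZero.polyAt P (φ 1)‖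
      ≤ EpsOrderZero.theta φ ε N P * ‖x‖ :=
  let φ' : A →L[ℂ] 𝓜(ℂ, B) := (EpsOrderZero.multiplierEmbedding B).toContinuousLinearMap.comp φ
  (proposition5p1_general (φ'.restrictScalars ℝ) hφ.1
    (fun _ _ => hφ.norm_multiplierEmbedding_mul_le) hP.le hx).trans
      (mul_le_mul_of_nonneg_right (EpsOrderZero.four_mul_sum_le_theta φ hφ.1 hP.le)
        (norm_nonneg x))
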